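/- Let $(M,d)$ be a complete metric space with at least three distinct points and a base point $0\in M$. Let $\mathrm{Lip}_0(M)$ be the Banach space of Lipschitz functions $f:M\to\mathbb R$ with $f(0)=0$, normed by the optimal Lipschitz constant. Let $\widetilde M=\{(x,y)\in M\times M: x\ne y\}$ and let $\beta\widetilde M$ be its Stone–Čech compactification. Let $M^{\mathcal U}$ be the uniform (Samuel) compactification of $M$, i.e. the closure of the image of $M$ in the cube indexed by all uniformly continuous functions $M\to[0,1]$; we regard $M$ as a subset of it. Write $d:\beta\widetilde M\to[0,\infty]$ for the continuous extension of $d|_{\widetilde M}$, and $p_1,p_2:\beta\widetilde M\to M^{\mathcal U}$ for the continuous extensions of $(x,y)\mapsto x$ and $(x,y)\mapsto y$. For $f\in \mathrm{Lip}_0(M)$ let $\Phi f\in C(\beta\widetilde M)$ be the continuous extension of $(x,y)\mapsto (f(x)-f(y))/d(x,y)$. For a finite positive Radon measure $\mu$ on $\beta\widetilde M$ define $\Phi^*\mu\in \mathrm{Lip}_0(M)^*$ by $\langle f,\Phi^*\mu\rangle=\int \Phi f\,d\mu$. For $\psi\in \mathrm{Lip}_0(M)^*$, the extended support $\mathcal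 S(\psi)\subset M^{\mathcal U}$ is the intersection of the closures in $M^{\mathcal U}$ of all sets $A\subset M$ such that $\langle f,\psi\rangle=0$ whenever $f\in \mathrm{Lip}_0(M)$ vanishes on $A$. Let $G$ be the set of all $g\in C(\beta\widetilde M)$ satisfying $d(x,y)g(x,y)\le d(x,u)g(x,u)+d(u,y)g(u,y)$ for all distinct $x,u,y\in M$. For finite positive Radon measures on $\beta\widetilde M$, write $\mu\preccurlyeq\nu$ if $\int g\,d\mu\le\int g\,d\nu$ for all $g\in G$; call $\mu$ minimal if $\nu\preccurlyeq\mu$ implies $\mu\preccurlyeq\nu$ for every finite positive Radon measure $\nu$. **Theorem.** Let $\mu$ be a finite positive Radon measure on $\beta\widetilde M$ that is minimal and concentrated on $d^{-1}[0,\infty)$. Then $$p_1(\operatorname{supp}\mu)\cup p_2(\operatorname{supp}\mu)\subset \mathcal S(\Phi^*\mu)\cup\{0\}.$$ Consequently $\mu$ is minimally supported: for every finite positive Radon measure $\nu$ on $\beta\widetilde M$ with $\Phi^*\nu=\Phi^*\mu$, $$p_1(\operatorname{supp}\mu)\cup p_2(\operatorname{supp}\mu)\subset p_1(\operatorname{supp}\nu)\cup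 p_2(\operatorname{supp}\nu)\cup\{0\}.$$ -/

import Mathlib

open MeasureTheory Set
open scoped NNReal ENNReal BoundedContinuousFunction

noncomputable section

namespace LipFree

/-! ### Continuous extensions to the Stone-Čech compactification -/

/-- The continuous extension to `StoneCech X` of a bounded continuous real function on `X`. -/
def extendReal {X : Type*} [TopologicalSpace X] (f : X →ᵇ ℝ) : C(StoneCech X, ℝ) where
  toFun ζ := (stoneCechExtend (β := Metric.closedBall (0 : ℝ) ‖f‖)
    (g := fun x => ⟨f x, by simpa using f.norm_coe_le_norm x⟩)
    (by fun_prop) ζ : ℝ)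
  continuous_toFun := continuous_subtype_val.comp (continuous_stoneCechExtend _)

@[simp]
theorem extendReal_unit {X : Type*} [TopologicalSpace X] (f : X →ᵇ ℝ) (x : X) :
    extendReal f (stoneCechUnit x) = f x := by
  simp [extendReal]

theorem eq_of_unit {X : Type*} [TopologicalSpace X] {g h : C(StoneCech X, ℝ)}
    (H : ∀ x, g (stoneCechUnit x) = h (stoneCechUnit x)) : g = h :=
  DFunLike.coe_injective (stoneCech_hom_ext g.continuous h.continuous (funext H))

/-- The Borel σ-algebra on the Stone-Čech compactification. -/
instance {X : Type*} [TopologicalSpace X] : MeasurableSpace (StoneCech X) := borel _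

instance {X : Type*} [TopologicalSpace X] : BorelSpace (StoneCech X) := ⟨rfl⟩

/-! ### The Lipschitz space -/

/-- The linear space of Lipschitz functions `f : M → ℝ` with `f o = 0`. -/
def lipSubmodule (M : Type*) [MetricSpace M] (o : M) : Submodule ℝ (M → ℝ) where
  carrier := {f | f o = 0 ∧ ∃ K : ℝ≥0, LipschitzWith K f}
  add_mem' := by
    rintro f g ⟨hf, K, hK⟩ ⟨hg, L, hL⟩
    exact ⟨by simp [hf, hg], K + L, hK.add hL⟩
  zero_mem' := ⟨rfl, 0, LipschitzWith.const 0⟩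
  smul_mem' := by
    rintro c f ⟨hf, K, hK⟩
    refine ⟨by simp [hf], ‖c‖₊ * K, LipschitzWith.of_dist_le_mul fun x y => ?_⟩
    have h := hK.dist_le_mul x y
    simp only [Pi.smul_apply, dist_smul₀, NNReal.coe_mul, coe_nnnorm, mul_assoc]
    gcongr

/-- The Lipschitz space `Lip₀(M)` of the metric space `M` with base point `o`. (A separate type,
so that it carries the Lipschitz norm and not the topology of pointwise convergence.) -/
def Lip0 (M : Type*) [MetricSpace M] (o : M) : Type _ := lipSubmodule M o

variable {M : Type*} [MetricSpace M] {o : M}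

instance : AddCommGroup (Lip0 M o) := inferInstanceAs (AddCommGroup (lipSubmodule M o))

instance : Module ℝ (Lip0 M o) := inferInstanceAs (Module ℝ (lipSubmodule M o))

instance : FunLike (Lip0 M o) M ℝ where
  coe f := f.1
  coe_injective := Subtype.val_injective

/-! ### Pairs of distinct points and the De Leeuw transform -/

/-- The space of pairs `(x, y)` of distinct points of `M`. -/
abbrev Pairs (M : Type*) : Type _ := {p : M × M // p.1 ≠ p.2}

theorem Lip0.lipschitz (f : Lip0 M o) : ∃ K : ℝ≥0, LipschitzWith K f := f.2.2

/-- The function `(x, y) ↦ (f x - f y) / d(x, y)` on pairs of distinct points. -/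
def slope (f : Lip0 M o) : Pairs M →ᵇ ℝ :=
  BoundedContinuousFunction.ofNormedAddCommGroup
    (fun p => (f p.1.1 - f p.1.2) / dist p.1.1 p.1.2)
    (by
      obtain ⟨K, hK⟩ := f.lipschitz
      have := hK.continuous
      exact Continuous.div (by fun_prop) (by fun_prop) fun p => dist_ne_zero.2 p.2)
    f.lipschitz.choose
    (by
      intro p
      have h := f.lipschitz.choose_spec.dist_le_mul p.1.1 p.1.2
      rw [Real.dist_eq] at h
      rw [Real.norm_eq_abs, abs_div, abs_of_nonneg dist_nonneg]
      exact (div_le_iff₀ (dist_pos.2 p.2)).2 h)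

@[simp]
theorem slope_apply (f : Lip0 M o) (p : Pairs M) :
    slope f p = (f p.1.1 - f p.1.2) / dist p.1.1 p.1.2 := rfl

/-- The De Leeuw transform `Φ : Lip₀(M) → C(βM̃)`, as a linear map. -/
def deLeeuw (M : Type*) [MetricSpace M] (o : M) : Lip0 M o →ₗ[ℝ] C(StoneCech (Pairs M), ℝ) where
  toFun f := extendReal (slope f)
  map_add' f g := eq_of_unit fun p => by
    change extendReal _ _ = extendReal _ _ + extendReal _ _
    have h (x : M) : (f + g) x = f x + g x := rfl
    simp only [extendReal_unit, slope_apply, h]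
    ring
  map_smul' c f := eq_of_unit fun p => by
    change extendReal _ _ = c * extendReal _ _
    have h (x : M) : (c • f) x = c * f x := rfl
    simp only [extendReal_unit, slope_apply, h]
    ring

@[simp]
theorem deLeeuw_unit (f : Lip0 M o) (p : Pairs M) :
    deLeeuw M o f (stoneCechUnit p) = (f p.1.1 - f p.1.2) / dist p.1.1 p.1.2 :=
  extendReal_unit _ _

theorem deLeeuw_injective : Function.Injective (deLeeuw M o) := by
  intro f g h
  refine DFunLike.ext _ _ fun x => ?_
  have hf : f o = 0 := f.2.1
  have hg : g o = 0 := g.2.1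
  by_cases hx : x = o
  · rw [hx, hf, hg]
  · have h' := DFunLike.congr_fun h (stoneCechUnit (⟨(x, o), hx⟩ : Pairs M))
    simpa [hf, hg, div_left_inj' (dist_ne_zero.2 hx)] using h'

/-- The norm of `Lip₀(M)`, transported along the (isometric) De Leeuw transform; it is the optimal
Lipschitz constant, see `norm_le_iff`. -/
instance : NormedAddCommGroup (Lip0 M o) :=
  NormedAddCommGroup.induced (Lip0 M o) C(StoneCech (Pairs M), ℝ) (deLeeuw M o) deLeeuw_injective

instance : NormedSpace ℝ (Lip0 M o) :=
  NormedSpace.induced ℝ (Lip0 M o) C(StoneCech (Pairs M), ℝ) (deLeeuw M o)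

theorem norm_deLeeuw (f : Lip0 M o) : ‖deLeeuw M o f‖ = ‖f‖ := rfl

theorem norm_le_iff (f : Lip0 M o) (K : ℝ≥0) : ‖f‖ ≤ K ↔ LipschitzWith K f := by
  rw [← norm_deLeeuw, ContinuousMap.norm_le _ K.coe_nonneg]
  constructor
  · intro h
    refine LipschitzWith.of_dist_le_mul fun x y => ?_
    by_cases hxy : x = y
    · simp [hxy]
    · have h' := h (stoneCechUnit (⟨(x, y), hxy⟩ : Pairs M))
      rw [deLeeuw_unit, Real.norm_eq_abs, abs_div, abs_of_nonneg dist_nonneg,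
        div_le_iff₀ (dist_pos.2 hxy)] at h'
      simpa [Real.dist_eq] using h'
  · intro h ζ
    have hc : IsClosed {ζ : StoneCech (Pairs M) | ‖deLeeuw M o f ζ‖ ≤ (K : ℝ)} :=
      isClosed_le (by fun_prop) continuous_const
    have := closure_minimal (s := range (stoneCechUnit (α := Pairs M))) (by
      rintro _ ⟨p, rfl⟩
      have h' := h.dist_le_mul p.1.1 p.1.2
      rw [Real.dist_eq] at h'
      rw [mem_ofPred_eq, deLeeuw_unit, Real.norm_eq_abs, abs_div, abs_of_nonneg dist_nonneg]
      exact (div_le_iff₀ (dist_pos.2 p.2)).2 h') hc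
    exact this (denseRange_stoneCechUnit ζ)

/-- The dual De Leeuw transform: for a finite positive measure `μ` on `βM̃`, the functional
`Φ*μ ∈ Lip₀(M)*` given by `⟨f, Φ*μ⟩ = ∫ Φ f dμ`. -/
def dualDeLeeuw (o : M) (μ : Measure (StoneCech (Pairs M))) [IsFiniteMeasure μ] :
    StrongDual ℝ (Lip0 M o) :=
  LinearMap.mkContinuous
    { toFun := fun f => ∫ ζ, deLeeuw M o f ζ ∂μ
      map_add' := fun f g => by
        rw [map_add]
        exact integral_add
          ((map_continuous (deLeeuw M o f)).integrable_of_hasCompactSupport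
            (HasCompactSupport.of_compactSpace _))
          ((map_continuous (deLeeuw M o g)).integrable_of_hasCompactSupport
            (HasCompactSupport.of_compactSpace _))
      map_smul' := fun c f => by
        rw [map_smul]
        exact integral_const_mul c _ }
    (μ.real univ)
    (fun f => by
      rw [mul_comm, ← norm_deLeeuw]
      exact norm_integral_le_of_norm_le_const (.of_forall fun ζ => (deLeeuw M o f).norm_coe_le_norm ζ))

/-! ### The uniform (Samuel) compactification and the coordinate maps -/

/-- The evaluation of a point of `M` at all uniformly continuous functions `M → [0, 1]`. -/
def evalUC (M : Type*) [MetricSpace M] (x : M) :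
    {f : M → unitInterval // UniformContinuous f} → unitInterval :=
  fun f => f.1 x

/-- The uniform (Samuel) compactification of `M`: the closure of the image of `M` in the cube
indexed by all uniformly continuous functions `M → [0, 1]`. -/
def UComp (M : Type*) [MetricSpace M] : Type _ := closure (range (evalUC M))

instance : TopologicalSpace (UComp M) := inferInstanceAs (TopologicalSpace (closure (range _)))

instance : T2Space (UComp M) := inferInstanceAs (T2Space (closure (range _)))

instance : CompactSpace (UComp M) := isCompact_iff_compactSpace.1 isClosed_closure.isCompact

/-- The canonical map of `M` into its uniform compactification. -/
def toUComp (x : M) : UComp M := ⟨evalUC M x, subset_closure (mem_range_self x)⟩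

theorem continuous_toUComp : Continuous (toUComp : M → UComp M) :=
  Continuous.subtype_mk (continuous_pi fun f => f.2.continuous) _

/-- The coordinate map `p₁ : βM̃ → Mᵁ`, extending `(x, y) ↦ x`. -/
def p₁ : StoneCech (Pairs M) → UComp M :=
  stoneCechExtend (g := fun p : Pairs M => toUComp p.1.1)
    (continuous_toUComp.comp (continuous_fst.comp continuous_subtype_val))

/-- The coordinate map `p₂ : βM̃ → Mᵁ`, extending `(x, y) ↦ y`. -/
def p₂ : StoneCech (Pairs M) → UComp M :=
  stoneCechExtend (g := fun p : Pairs M => toUComp p.1.2)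
    (continuous_toUComp.comp (continuous_snd.comp continuous_subtype_val))

/-- The shadow `p₁(E) ∪ p₂(E)` of a set `E ⊆ βM̃`. -/
def shadow (E : Set (StoneCech (Pairs M))) : Set (UComp M) := p₁ '' E ∪ p₂ '' E

/-- The continuous extension `d : βM̃ → [0, ∞]` of the metric. -/
def dExt : StoneCech (Pairs M) → ℝ≥0∞ :=
  stoneCechExtend (g := fun p : Pairs M => edist p.1.1 p.1.2) (by fun_prop)

/-- The extended support of `ψ ∈ Lip₀(M)*`: the intersection of the closures in `Mᵁ` of all
`A ⊆ M` such that `⟨f, ψ⟩ = 0` whenever `f ∈ Lip₀(M)` vanishes on `A`. -/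
def extendedSupport (ψ : StrongDual ℝ (Lip0 M o)) : Set (UComp M) :=
  ⋂ A ∈ {A : Set M | ∀ f : Lip0 M o, (∀ x ∈ A, f x = 0) → ψ f = 0}, closure (toUComp '' A)

/-! ### The cone `G` and the quasi-order -/

/-- The cone `G` of all `g ∈ C(βM̃)` with `d(x,y) g(x,y) ≤ d(x,u) g(x,u) + d(u,y) g(u,y)` for all
distinct points `x, u, y` of `M`. -/
def coneG (M : Type*) [MetricSpace M] : Set C(StoneCech (Pairs M), ℝ) :=
  {g | ∀ (x u y : M) (hxu : x ≠ u) (huy : u ≠ y) (hxy : x ≠ y),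
    dist x y * g (stoneCechUnit ⟨(x, y), hxy⟩) ≤
      dist x u * g (stoneCechUnit ⟨(x, u), hxu⟩) + dist u y * g (stoneCechUnit ⟨(u, y), huy⟩)}

/-- The quasi-order: `μ ≼ ν` if and only if `∫ g dμ ≤ ∫ g dν` for all `g ∈ G`. -/
def Precedes (μ ν : Measure (StoneCech (Pairs M))) : Prop :=
  ∀ g ∈ coneG M, ∫ ζ, g ζ ∂μ ≤ ∫ ζ, g ζ ∂ν

/-- Minimality of `μ` among the positive finite Radon measures on `βM̃`. -/
def IsMinimal (μ : Measure (StoneCech (Pairs M))) : Prop :=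
  ∀ ν : Measure (StoneCech (Pairs M)), IsFiniteMeasure ν → ν.Regular →
    Precedes ν μ → Precedes μ ν

end LipFree

end

/-!
Suppose that `ξ` lies neither in the extended support of `Φ*μ` nor at the base point `o`. Then there
is a set `B ∋ o` in `M` whose closure misses `ξ` and such that `⟨f, Φ*μ⟩ = 0` whenever `f` vanishes
on `B`. Let `h` be the distance to `B` truncated at `1`; it extends continuously to `Mᵁ` and is
positive at `ξ` (`truncInfDistExt_pos`). The function `f(x, y) = min (d(x, y)) (h x) / d(x, y)`
belongs to the cone `G` (`extend_truncSlope_fst_mem_coneG`) and is positive at every point of `βM̃`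
with finite distance whose first coordinate is near `ξ` (`extend_truncSlope_pos`). As `μ` is
concentrated on finite distances, `ξ ∉ p₁(supp μ)` follows from `∫ f dμ = 0`; for `p₂` one takes
`h y` instead of `h x`.

By minimality it suffices to find `ν ≼ μ` with `∫ f dν = 0`. By the Hahn–Banach and Riesz theorems
such a `ν` exists as soon as `∫ g dμ ≥ 0` for all `g ∈ G` with `g ≥ -f`
(`exists_precedes_integral_eq_zero`). For such `g` the cost `c(x, y) = d(x, y) g(x, y)`, with
`c(x, x) = 0`, satisfies the triangle inequality, so the potential `k(x) = inf_w c(x, w)` satisfies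
`k(x) - k(u) ≤ c(x, u)`, that is, `Φ k ≤ g`. Since `c(x, ·) ≥ -h(x)`, the potential is finite and
vanishes on `B`. Hence `∫ g dμ ≥ ∫ Φ k dμ = ⟨k, Φ*μ⟩ = 0` (`integral_nonneg_of_cost_bound_left`).

Minimal support follows because `𝒮(Φ*ν)` is contained in the shadow of the support of `ν`, for any
finite Radon measure `ν` (`extendedSupport_subset_shadow_support`).
-/

open MeasureTheory Set
open scoped NNReal ENNReal BoundedContinuousFunction

noncomputable section

namespace LipFree

/-! ### Integration and density on compactifications -/

theorem integrable_of_compactSpace {X : Type*} [TopologicalSpace X] [CompactSpace X]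
    [MeasurableSpace X] [BorelSpace X] (μ : Measure X) [IsFiniteMeasure μ] (φ : C(X, ℝ)) :
    Integrable φ μ :=
  (map_continuous φ).integrable_of_hasCompactSupport (HasCompactSupport.of_compactSpace _)

/-- The Riesz–Markov–Kakutani theorem on a compact space, stated for `C(X, ℝ)` instead of
compactly supported functions. -/
theorem exists_measure_integral_eq {X : Type*} [TopologicalSpace X] [CompactSpace X] [T2Space X]
    [MeasurableSpace X] [BorelSpace X] (Λ : C(X, ℝ) →ₗ[ℝ] ℝ) (hΛ : ∀ φ, 0 ≤ φ → 0 ≤ Λ φ) :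
    ∃ ν : Measure X, IsFiniteMeasure ν ∧ ν.Regular ∧ ∀ φ : C(X, ℝ), ∫ x, φ x ∂ν = Λ φ := by
  let Λc : CompactlySupportedContinuousMap X ℝ →ₚ[ℝ] ℝ := PositiveLinearMap.mk₀
    { toFun := fun φ => Λ φ.toContinuousMap
      map_add' := fun φ ψ => map_add Λ φ.toContinuousMap ψ.toContinuousMap
      map_smul' := fun c φ => map_smul Λ c φ.toContinuousMap }
    (fun φ hφ => hΛ _ fun x => hφ x)
  have hreg : (RealRMK.rieszMeasure Λc).Regular := inferInstance
  exact ⟨RealRMK.rieszMeasure Λc, ⟨isCompact_univ.measure_lt_top⟩, hreg, fun φ =>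
    RealRMK.integral_rieszMeasure Λc (CompactlySupportedContinuousMap.continuousMapEquiv φ)⟩

/-- A closed condition that holds at the points of `X` lying in an open set `U` of its Stone-Čech
compactification holds throughout `U`. -/
theorem subset_of_stoneCechUnit_mem {X : Type*} [TopologicalSpace X]
    {U C : Set (StoneCech X)} (hU : IsOpen U) (hC : IsClosed C)
    (h : ∀ x, stoneCechUnit x ∈ U → stoneCechUnit x ∈ C) : U ⊆ C := by
  refine (Dense.open_subset_closure_inter denseRange_stoneCechUnit hU).trans
    (closure_minimal ?_ hC)
  rintro _ ⟨hx, x, rfl⟩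
  exact h x hx

variable {M : Type*} [MetricSpace M] {o : M}

/-! ### Hahn–Banach duality for the quasi-order -/

theorem add_mem_coneG {g h : C(StoneCech (Pairs M), ℝ)} (hg : g ∈ coneG M) (hh : h ∈ coneG M) :
    g + h ∈ coneG M := by
  intro x u y hxu huy hxy
  have h₁ := hg x u y hxu huy hxy
  have h₂ := hh x u y hxu huy hxy
  simp only [ContinuousMap.add_apply]
  linarith

theorem smul_mem_coneG {g : C(StoneCech (Pairs M), ℝ)} (hg : g ∈ coneG M) {c : ℝ} (hc : 0 ≤ c) :
    c • g ∈ coneG M := by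
  intro x u y hxu huy hxy
  have h := mul_le_mul_of_nonneg_left (hg x u y hxu huy hxy) hc
  simp only [ContinuousMap.smul_apply, smul_eq_mul]
  linarith

theorem const_mem_coneG {c : ℝ} (hc : 0 ≤ c) :
    ContinuousMap.const (StoneCech (Pairs M)) c ∈ coneG M := by
  intro x u y _ _ _
  have h := mul_le_mul_of_nonneg_right (dist_triangle x u y) hc
  simp only [ContinuousMap.const_apply]
  linarith

/-- The upper envelope functional `φ ↦ inf {∫ g dμ : g ∈ G, φ ≤ g}`. It is sublinear, and the linear
functionals below it are the integrals against the measures `ν ≼ μ`. The infimum is not a junk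
value: the set contains the integral of the constant `‖φ‖` and is bounded below by `∫ φ dμ`. -/
def upperIntegral (μ : Measure (StoneCech (Pairs M))) (φ : C(StoneCech (Pairs M), ℝ)) : ℝ :=
  sInf ((fun g : C(StoneCech (Pairs M), ℝ) => ∫ ζ, g ζ ∂μ) '' {g | g ∈ coneG M ∧ φ ≤ g})

theorem le_upperIntegral {μ : Measure (StoneCech (Pairs M))} {φ : C(StoneCech (Pairs M), ℝ)} {a : ℝ}
    (h : ∀ g ∈ coneG M, φ ≤ g → a ≤ ∫ ζ, g ζ ∂μ) : a ≤ upperIntegral μ φ := by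
  refine le_csInf ⟨_, mem_image_of_mem _ ⟨const_mem_coneG (norm_nonneg φ), fun ζ => ?_⟩⟩ ?_
  · exact (le_abs_self _).trans (φ.norm_coe_le_norm ζ)
  · rintro _ ⟨g, ⟨hg, hφ⟩, rfl⟩
    exact h g hg hφ

section upperIntegral

variable {μ : Measure (StoneCech (Pairs M))} [IsFiniteMeasure μ]

theorem upperIntegral_le {φ g : C(StoneCech (Pairs M), ℝ)} (hg : g ∈ coneG M) (h : φ ≤ g) :
    upperIntegral μ φ ≤ ∫ ζ, g ζ ∂μ := by
  refine csInf_le ⟨∫ ζ, φ ζ ∂μ, ?_⟩ (mem_image_of_mem _ ⟨hg, h⟩)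
  rintro _ ⟨g', ⟨-, hφ⟩, rfl⟩
  exact integral_mono (integrable_of_compactSpace μ φ) (integrable_of_compactSpace μ g') hφ

theorem upperIntegral_add_le (φ ψ : C(StoneCech (Pairs M), ℝ)) :
    upperIntegral μ (φ + ψ) ≤ upperIntegral μ φ + upperIntegral μ ψ := by
  -- the two infima on the right are replaced by their members one at a time
  rw [← sub_le_iff_le_add]
  refine le_upperIntegral fun g hg hφ => ?_
  rw [sub_le_comm]
  refine le_upperIntegral fun g' hg' hψ => ?_
  rw [sub_le_iff_le_add', ← integral_add (integrable_of_compactSpace μ g)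
    (integrable_of_compactSpace μ g')]
  exact upperIntegral_le (add_mem_coneG hg hg') (add_le_add hφ hψ)

theorem upperIntegral_smul_le {c : ℝ} (hc : 0 < c) (φ : C(StoneCech (Pairs M), ℝ)) :
    upperIntegral μ (c • φ) ≤ c * upperIntegral μ φ := by
  rw [← div_le_iff₀' hc]
  refine le_upperIntegral fun g hg hφ => ?_
  rw [div_le_iff₀' hc, ← integral_const_mul]
  exact upperIntegral_le (smul_mem_coneG hg hc.le) (smul_le_smul_of_nonneg_left hφ hc.le)

theorem upperIntegral_smul {c : ℝ} (hc : 0 < c) (φ : C(StoneCech (Pairs M), ℝ)) :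
    upperIntegral μ (c • φ) = c * upperIntegral μ φ := by
  refine (upperIntegral_smul_le hc φ).antisymm ?_
  have h := upperIntegral_smul_le (μ := μ) (inv_pos.2 hc) (c • φ)
  rwa [inv_smul_smul₀ hc.ne', ← div_eq_inv_mul, le_div_iff₀' hc] at h

/-- Hahn–Banach duality: if no element of `G` above `-f` has negative `μ`-integral, some `ν ≼ μ`
does not charge `f`. -/
theorem exists_precedes_integral_eq_zero {f : C(StoneCech (Pairs M), ℝ)} (hf : 0 ≤ f)
    (h : ∀ g ∈ coneG M, -f ≤ g → 0 ≤ ∫ ζ, g ζ ∂μ) :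
    ∃ ν : Measure (StoneCech (Pairs M)), IsFiniteMeasure ν ∧ ν.Regular ∧ Precedes ν μ ∧
      ∫ ζ, f ζ ∂ν = 0 := by
  -- the zero functional on the line `ℝ f` is dominated by the upper envelope, hence extends
  have hdom : ∀ φ ∈ Submodule.span ℝ {f}, 0 ≤ upperIntegral μ φ := by
    intro φ hφ
    obtain ⟨t, rfl⟩ := Submodule.mem_span_singleton.1 hφ
    rcases le_or_gt 0 t with ht | ht
    · exact le_upperIntegral fun g _ hg =>
        integral_nonneg ((smul_nonneg ht hf).trans hg)
    · rw [← neg_smul_neg, upperIntegral_smul (neg_pos.2 ht)]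
      exact mul_nonneg (neg_pos.2 ht).le (le_upperIntegral h)
  obtain ⟨Λ, hΛf, hΛ⟩ := exists_extension_of_le_sublinear
    (⟨Submodule.span ℝ {f}, 0⟩ : C(StoneCech (Pairs M), ℝ) →ₗ.[ℝ] ℝ) (upperIntegral μ)
    (fun c hc φ => upperIntegral_smul hc φ) upperIntegral_add_le (fun φ => hdom φ φ.2)
  obtain ⟨ν, hν, hreg, hνΛ⟩ := exists_measure_integral_eq Λ fun φ hφ => by
    -- `0 ∈ G` lies above `-φ`, so the envelope of `-φ` is at most `0`
    have h₀ := (hΛ (-φ)).trans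
      (upperIntegral_le (const_mem_coneG le_rfl) (neg_nonpos.2 hφ))
    simpa using h₀
  refine ⟨ν, hν, hreg, fun g hg => ?_, ?_⟩
  · rw [hνΛ]
    exact (hΛ g).trans (upperIntegral_le hg le_rfl)
  · rw [hνΛ]
    exact hΛf ⟨f, Submodule.mem_span_singleton_self f⟩

theorem IsMinimal.integral_eq_zero (hmin : IsMinimal μ) {f : C(StoneCech (Pairs M), ℝ)}
    (hfG : f ∈ coneG M) (hf : 0 ≤ f) (h : ∀ g ∈ coneG M, -f ≤ g → 0 ≤ ∫ ζ, g ζ ∂μ) :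
    ∫ ζ, f ζ ∂μ = 0 := by
  obtain ⟨ν, hν, hreg, hνμ, hνf⟩ := exists_precedes_integral_eq_zero hf h
  exact ((hmin ν hν hreg hνμ f hfG).trans_eq hνf).antisymm (integral_nonneg hf)

end upperIntegral

/-! ### The cost function of an element of the cone -/

/-- The cost `c(x, y) = d(x, y) g(x, y)` attached to `g`, with `c(x, x) = 0`. For `g ∈ G` it
satisfies the triangle inequality, but it may be negative and need not be symmetric. -/
def cost (g : C(StoneCech (Pairs M), ℝ)) (x y : M) : ℝ :=
  open Classical in if h : x = y then 0 else dist x y * g (stoneCechUnit ⟨(x, y), h⟩)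

theorem cost_self (g : C(StoneCech (Pairs M), ℝ)) (x : M) : cost g x x = 0 := by simp [cost]

theorem cost_of_ne (g : C(StoneCech (Pairs M), ℝ)) {x y : M} (h : x ≠ y) :
    cost g x y = dist x y * g (stoneCechUnit ⟨(x, y), h⟩) := by simp [cost, h]

theorem cost_le (g : C(StoneCech (Pairs M), ℝ)) (x y : M) : cost g x y ≤ ‖g‖ * dist x y := by
  by_cases h : x = y
  · simp [cost, h]
  · rw [cost_of_ne g h, mul_comm]
    exact mul_le_mul_of_nonneg_right ((le_abs_self _).trans (g.norm_coe_le_norm _)) dist_nonneg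

/-- The triangle inequality also holds when some of the points coincide. The case `x = y` says
`0 ≤ c(x, u) + c(u, x)`, which needs a third point. -/
theorem cost_triangle (hM : ∃ x y z : M, x ≠ y ∧ y ≠ z ∧ x ≠ z) {g : C(StoneCech (Pairs M), ℝ)}
    (hg : g ∈ coneG M) (x u y : M) : cost g x y ≤ cost g x u + cost g u y := by
  have key : ∀ {x u y : M}, x ≠ u → u ≠ y → x ≠ y → cost g x y ≤ cost g x u + cost g u y := by
    intro x u y hxu huy hxy
    rw [cost_of_ne g hxu, cost_of_ne g huy, cost_of_ne g hxy]
    exact hg x u y hxu huy hxy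
  by_cases hxu : x = u
  · simp [hxu, cost_self]
  by_cases huy : u = y
  · simp [huy, cost_self]
  by_cases hxy : x = y
  · subst hxy
    obtain ⟨z, hzx, hzu⟩ : ∃ z, z ≠ x ∧ z ≠ u := by
      obtain ⟨a, b, c, hab, hbc, hac⟩ := hM
      by_contra! H
      by_cases ha : a = x
      · exact hbc ((H b (ha ▸ hab.symm)).trans (H c (ha ▸ hac.symm)).symm)
      · by_cases hb : b = x
        · exact hac ((H a ha).trans (H c (hb ▸ hbc.symm)).symm)
        · exact hab ((H a ha).trans (H b hb).symm)
    have h₁ := key hxu hzu.symm hzx.symm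
    have h₂ := key huy hzx.symm hzu.symm
    rw [cost_self]
    linarith
  · exact key hxu huy hxy

/-- A function `k` with `k x - k u ≤ c(x, u)` is Lipschitz and satisfies `Φ k ≤ g`. If moreover `k`
vanishes on a set `B` outside of which `Φ*μ` is zero, then `0 = ⟨k, Φ*μ⟩ ≤ ∫ g dμ`. -/
theorem integral_nonneg_of_sub_le_cost {μ : Measure (StoneCech (Pairs M))} [IsFiniteMeasure μ]
    {B : Set M} (hoB : o ∈ B)
    (hB : ∀ f : Lip0 M o, (∀ x ∈ B, f x = 0) → dualDeLeeuw o μ f = 0)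
    {g : C(StoneCech (Pairs M), ℝ)} {k : M → ℝ} (hk : ∀ x u, k x - k u ≤ cost g x u)
    (hkB : ∀ x ∈ B, k x = 0) : 0 ≤ ∫ ζ, g ζ ∂μ := by
  let k' : Lip0 M o := ⟨k, hkB o hoB, ‖g‖₊, LipschitzWith.of_le_add_mul _ fun x y => by
    have h₁ := hk x y
    have h₂ := cost_le g x y
    rw [coe_nnnorm]
    linarith⟩
  have hle : ∀ ζ, deLeeuw M o k' ζ ≤ g ζ := fun ζ =>
    subset_of_stoneCechUnit_mem isOpen_univ
      (isClosed_le (map_continuous (deLeeuw M o k')) (map_continuous g)) (fun p _ => by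
        have h := hk p.1.1 p.1.2
        rw [cost_of_ne g p.2] at h
        rw [mem_ofPred_eq, deLeeuw_unit, div_le_iff₀' (dist_pos.2 p.2)]
        exact h) (mem_univ ζ)
  exact (hB k' hkB).ge.trans (integral_mono (integrable_of_compactSpace μ _)
    (integrable_of_compactSpace μ g) hle)

/-- The potential used here is `k x = inf_w c(x, w)`: it is at most `c(x, x) = 0`, and it is
nonnegative wherever `c(x, ·)` is, so it vanishes on `B`. -/
theorem integral_nonneg_of_cost_bound_left (hM : ∃ x y z : M, x ≠ y ∧ y ≠ z ∧ x ≠ z)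
    {μ : Measure (StoneCech (Pairs M))} [IsFiniteMeasure μ] {B : Set M} (hoB : o ∈ B)
    (hB : ∀ f : Lip0 M o, (∀ x ∈ B, f x = 0) → dualDeLeeuw o μ f = 0)
    {g : C(StoneCech (Pairs M), ℝ)} (hg : g ∈ coneG M) {b : M → ℝ}
    (hb : ∀ x ∈ B, b x = 0) (hgb : ∀ x y, -b x ≤ cost g x y) : 0 ≤ ∫ ζ, g ζ ∂μ := by
  have hbdd : ∀ x, BddBelow (range (cost g x)) := fun x => ⟨-b x, by
    rintro _ ⟨y, rfl⟩; exact hgb x y⟩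
  have : Nonempty M := ⟨o⟩
  refine integral_nonneg_of_sub_le_cost hoB hB (k := fun x => ⨅ w, cost g x w) (fun x u => ?_)
    fun x hx => ?_
  · rw [sub_le_comm]
    refine le_ciInf fun w => ?_
    have h₁ := ciInf_le (hbdd x) w
    have h₂ := cost_triangle hM hg x u w
    linarith
  · refine le_antisymm ((ciInf_le (hbdd x) x).trans_eq (cost_self g x)) (le_ciInf fun y => ?_)
    simpa [hb x hx] using hgb x y

/-- The mirror image of `integral_nonneg_of_cost_bound_left`, with `k x = -inf_w c(w, x)`. -/
theorem integral_nonneg_of_cost_bound_right (hM : ∃ x y z : M, x ≠ y ∧ y ≠ z ∧ x ≠ z)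
    {μ : Measure (StoneCech (Pairs M))} [IsFiniteMeasure μ] {B : Set M} (hoB : o ∈ B)
    (hB : ∀ f : Lip0 M o, (∀ x ∈ B, f x = 0) → dualDeLeeuw o μ f = 0)
    {g : C(StoneCech (Pairs M), ℝ)} (hg : g ∈ coneG M) {b : M → ℝ}
    (hb : ∀ x ∈ B, b x = 0) (hgb : ∀ x y, -b y ≤ cost g x y) : 0 ≤ ∫ ζ, g ζ ∂μ := by
  have hbdd : ∀ y, BddBelow (range fun x => cost g x y) := fun y => ⟨-b y, by
    rintro _ ⟨x, rfl⟩; exact hgb x y⟩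
  have : Nonempty M := ⟨o⟩
  refine integral_nonneg_of_sub_le_cost hoB hB (k := fun x => -⨅ w, cost g w x) (fun x u => ?_)
    fun x hx => ?_
  · rw [sub_neg_eq_add, neg_add_le_iff_le_add, ← sub_le_iff_le_add]
    refine le_ciInf fun w => ?_
    have h₁ := ciInf_le (hbdd u) w
    have h₂ := cost_triangle hM hg w x u
    linarith
  · rw [neg_eq_zero]
    refine le_antisymm ((ciInf_le (hbdd x) x).trans_eq (cost_self g x)) (le_ciInf fun y => ?_)
    simpa [hb x hx] using hgb y x

/-! ### The truncated distance to a set, on the uniform compactification -/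

/-- The distance to `B`, truncated at `1`: a `1`-Lipschitz function `M → [0, 1]`, hence one of the
coordinates of the uniform compactification. -/
def truncInfDist (B : Set M) (x : M) : unitInterval :=
  ⟨min 1 (Metric.infDist x B), le_min zero_le_one Metric.infDist_nonneg, min_le_left _ _⟩

theorem truncInfDist_le_add (B : Set M) (x y : M) :
    (truncInfDist B x : ℝ) ≤ dist x y + truncInfDist B y := by
  have h := Metric.infDist_le_infDist_add_dist (s := B) (x := x) (y := y)
  have hd := dist_nonneg (x := x) (y := y)
  change min _ _ ≤ _ + min _ _
  grind

theorem truncInfDist_of_mem {B : Set M} {x : M} (hx : x ∈ B) : (truncInfDist B x : ℝ) = 0 := by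
  simp [truncInfDist, Metric.infDist_zero_of_mem hx]

theorem uniformContinuous_truncInfDist (B : Set M) : UniformContinuous (truncInfDist B) := by
  refine LipschitzWith.uniformContinuous (K := 1) (LipschitzWith.of_dist_le_mul fun x y => ?_)
  have h₁ := truncInfDist_le_add B x y
  have h₂ := truncInfDist_le_add B y x
  rw [dist_comm y x] at h₂
  rw [Subtype.dist_eq, Real.dist_eq, abs_le, NNReal.coe_one, one_mul]
  constructor <;> linarith

/-- The continuous extension of the truncated distance to `B` to the uniform compactification. -/
def truncInfDistExt (B : Set M) (ξ : UComp M) : ℝ :=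
  ξ.1 ⟨truncInfDist B, uniformContinuous_truncInfDist B⟩

theorem continuous_truncInfDistExt (B : Set M) : Continuous (truncInfDistExt B) :=
  continuous_subtype_val.comp ((continuous_apply _).comp continuous_subtype_val)

theorem truncInfDistExt_toUComp (B : Set M) (x : M) :
    truncInfDistExt B (toUComp x) = truncInfDist B x := rfl

theorem mem_closure_image_toUComp {B : Set M} {ξ : UComp M} :
    ξ ∈ closure (toUComp '' B) ↔ ξ.1 ∈ closure (evalUC M '' B) := by
  have h : Topology.IsInducing (fun ξ : UComp M => ξ.1) := Topology.IsInducing.subtypeVal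
  rw [h.closure_eq_preimage_closure_image, mem_preimage, image_image]
  rfl

theorem denseRange_toUComp : DenseRange (toUComp : M → UComp M) := fun ξ => by
  rw [← image_univ, mem_closure_image_toUComp, image_univ]
  exact ξ.2

/-- The closure of `B` in the uniform compactification contains the zero set of the extended
truncated distance to `B`. -/
theorem truncInfDistExt_pos {B : Set M} (hB : B.Nonempty) {ξ : UComp M}
    (hξ : ξ ∉ closure (toUComp '' B)) : 0 < truncInfDistExt B ξ := by
  by_contra! hle
  refine hξ ?_
  have huc : UniformContinuous (evalUC M) := uniformContinuous_pi.2 fun f => f.2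
  rw [mem_closure_image_toUComp, UniformSpace.mem_closure_iff_ball]
  intro V hV
  obtain ⟨W, hW, hWV⟩ := comp_mem_uniformity_sets hV
  obtain ⟨δ, hδ, hδW⟩ := Metric.mem_uniformity_dist.1 (huc hW)
  have hval : ContinuousAt (fun η : UComp M => η.1) ξ := continuous_subtype_val.continuousAt
  have hnear : ∀ᶠ η : UComp M in nhds ξ, (ξ.1, η.1) ∈ W ∧ truncInfDistExt B η < min 1 δ :=
    (hval.eventually (UniformSpace.ball_mem_nhds ξ.1 hW)).and
      ((continuous_truncInfDistExt B).continuousAt.eventually_lt_const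
        (hle.trans_lt (lt_min one_pos hδ)))
  obtain ⟨_, ⟨x, rfl⟩, hxW, hxδ⟩ :=
    ((mem_closure_iff_frequently.1 (denseRange_toUComp ξ)).and_eventually hnear).exists
  have hx : Metric.infDist x B < δ := by
    rw [truncInfDistExt_toUComp] at hxδ
    change min _ _ < _ at hxδ
    grind
  obtain ⟨b, hb, hxb⟩ := (Metric.infDist_lt_iff hB).1 hx
  exact ⟨evalUC M b, hWV ⟨evalUC M x, hxW, hδW hxb⟩, mem_image_of_mem _ hb⟩

/-! ### The test functions of the cone -/

/-- The function `min (d(x, y)) (h (q (x, y))) / d(x, y)` on pairs, where `h` is the truncated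
distance to `B` and `q` is meant to be one of the two coordinates. -/
def truncSlope (B : Set M) (q : Pairs M → M) (hq : Continuous q) : Pairs M →ᵇ ℝ :=
  BoundedContinuousFunction.ofNormedAddCommGroup
    (fun p => min (dist p.1.1 p.1.2) (truncInfDist B (q p)) / dist p.1.1 p.1.2)
    (by
      have := (uniformContinuous_truncInfDist B).continuous
      exact Continuous.div (by fun_prop) (by fun_prop) fun p => dist_ne_zero.2 p.2)
    1
    (fun p => by
      rw [Real.norm_of_nonneg (div_nonneg (le_min dist_nonneg (truncInfDist B (q p)).2.1)
        dist_nonneg)]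
      exact div_le_one_of_le₀ (min_le_left _ _) dist_nonneg)

theorem extend_truncSlope_unit (B : Set M) {q : Pairs M → M} (hq : Continuous q) (p : Pairs M) :
    extendReal (truncSlope B q hq) (stoneCechUnit p) =
      min (dist p.1.1 p.1.2) (truncInfDist B (q p)) / dist p.1.1 p.1.2 :=
  extendReal_unit _ _

theorem dist_mul_extend_truncSlope (B : Set M) {q : Pairs M → M} (hq : Continuous q)
    (p : Pairs M) :
    dist p.1.1 p.1.2 * extendReal (truncSlope B q hq) (stoneCechUnit p) =
      min (dist p.1.1 p.1.2) (truncInfDist B (q p)) := by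
  rw [extend_truncSlope_unit, mul_div_cancel₀ _ (dist_ne_zero.2 p.2)]

theorem extend_truncSlope_nonneg (B : Set M) {q : Pairs M → M} (hq : Continuous q) :
    0 ≤ extendReal (truncSlope B q hq) := fun ζ =>
  subset_of_stoneCechUnit_mem isOpen_univ (isClosed_le continuous_const
    (map_continuous (extendReal (truncSlope B q hq)))) (fun p _ => by
      rw [mem_ofPred_eq, extend_truncSlope_unit]
      exact div_nonneg (le_min dist_nonneg (truncInfDist B (q p)).2.1) dist_nonneg) (mem_univ ζ)

theorem neg_truncInfDist_le_cost {B : Set M} {q : Pairs M → M} {hq : Continuous q}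
    {g : C(StoneCech (Pairs M), ℝ)} (h : -extendReal (truncSlope B q hq) ≤ g) (p : Pairs M) :
    -(truncInfDist B (q p) : ℝ) ≤ cost g p.1.1 p.1.2 := by
  have hp : -extendReal (truncSlope B q hq) (stoneCechUnit p) ≤ g (stoneCechUnit p) :=
    h (stoneCechUnit p)
  have h₁ := mul_le_mul_of_nonneg_left hp (dist_nonneg (x := p.1.1) (y := p.1.2))
  rw [mul_neg, dist_mul_extend_truncSlope] at h₁
  rw [cost_of_ne g p.2]
  exact (neg_le_neg (min_le_right _ _)).trans h₁

theorem continuous_dExt : Continuous (dExt : StoneCech (Pairs M) → ℝ≥0∞) :=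
  continuous_stoneCechExtend _

/-- Near `ζ` the distance is less than some finite `R` and the truncated distance to `B` exceeds
some `η > 0`, so the test function is at least `min 1 (η / R)` there. -/
theorem extend_truncSlope_pos {B : Set M} {q : Pairs M → M} (hq : Continuous q)
    {π : StoneCech (Pairs M) → UComp M} (hπ : Continuous π)
    (hπq : ∀ p, π (stoneCechUnit p) = toUComp (q p)) {ζ : StoneCech (Pairs M)}
    (hd : dExt ζ < ⊤) (hζ : 0 < truncInfDistExt B (π ζ)) :
    0 < extendReal (truncSlope B q hq) ζ := by
  obtain ⟨R, hdR, -⟩ := ENNReal.lt_iff_exists_nnreal_btwn.1 hd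
  obtain ⟨η, hη, hηζ⟩ := exists_between hζ
  have hR : 0 < R := by exact_mod_cast (zero_le).trans_lt hdR
  have hU : IsOpen {ζ | dExt ζ < R ∧ η < truncInfDistExt B (π ζ)} :=
    (isOpen_Iio.preimage continuous_dExt).inter
      (isOpen_Ioi.preimage ((continuous_truncInfDistExt B).comp hπ))
  refine (lt_min one_pos (div_pos hη (NNReal.coe_pos.2 hR))).trans_le
    (subset_of_stoneCechUnit_mem hU (isClosed_le continuous_const
      (map_continuous (extendReal (truncSlope B q hq)))) (fun p hp => ?_) ⟨hdR, hηζ⟩)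
  obtain ⟨h₁, h₂⟩ := hp
  rw [dExt, stoneCechExtend_stoneCechUnit, edist_dist, ENNReal.ofReal_lt_coe_iff dist_nonneg] at h₁
  rw [hπq, truncInfDistExt_toUComp] at h₂
  have hp := dist_pos.2 p.2
  have hb := (hη.trans h₂).le
  rw [mem_ofPred_eq, extend_truncSlope_unit, ← min_div_div_right hp.le,
    div_self hp.ne']
  refine min_le_min le_rfl ?_
  gcongr

theorem truncInfDistExt_eq_zero_of_mem_support {μ : Measure (StoneCech (Pairs M))}
    [IsFiniteMeasure μ] (hconc : μ (dExt ⁻¹' Ico 0 ⊤)ᶜ = 0)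
    {B : Set M} {q : Pairs M → M} (hq : Continuous q)
    {π : StoneCech (Pairs M) → UComp M} (hπ : Continuous π)
    (hπq : ∀ p, π (stoneCechUnit p) = toUComp (q p))
    (h : ∫ ζ, extendReal (truncSlope B q hq) ζ ∂μ = 0) {ζ : StoneCech (Pairs M)}
    (hζ : ζ ∈ μ.support) : truncInfDistExt B (π ζ) ≤ 0 := by
  refine Measure.support_subset_of_isClosed
    (isClosed_le ((continuous_truncInfDistExt B).comp hπ) continuous_const) ?_ hζ
  have h₀ := (integral_eq_zero_iff_of_nonneg (extend_truncSlope_nonneg B hq)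
    (integrable_of_compactSpace μ _)).1 h
  filter_upwards [h₀, measure_eq_zero_iff_ae_notMem.1 hconc] with ζ hζ hd
  rw [notMem_compl_iff] at hd
  by_contra! hpos
  exact (extend_truncSlope_pos hq hπ hπq hd.2 hpos).ne' hζ

/-- The cost `min (d(x, y)) (h x)` satisfies the triangle inequality because `h` is `1`-Lipschitz
and nonnegative. -/
theorem extend_truncSlope_fst_mem_coneG (B : Set M) :
    extendReal (truncSlope B (fun p => p.1.1) (by fun_prop)) ∈ coneG M := by
  intro x u y hxu huy hxy
  have h₁ := dist_mul_extend_truncSlope B (q := fun p => p.1.1) (by fun_prop) ⟨(x, u), hxu⟩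
  have h₂ := dist_mul_extend_truncSlope B (q := fun p => p.1.1) (by fun_prop) ⟨(u, y), huy⟩
  have h₃ := dist_mul_extend_truncSlope B (q := fun p => p.1.1) (by fun_prop) ⟨(x, y), hxy⟩
  rw [h₁, h₂, h₃]
  have := dist_triangle x u y
  have := truncInfDist_le_add B x u
  have := (truncInfDist B u).2.1
  have := dist_nonneg (x := u) (y := y)
  grind

theorem extend_truncSlope_snd_mem_coneG (B : Set M) :
    extendReal (truncSlope B (fun p => p.1.2) (by fun_prop)) ∈ coneG M := by
  intro x u y hxu huy hxy
  have h₁ := dist_mul_extend_truncSlope B (q := fun p => p.1.2) (by fun_prop) ⟨(x, u), hxu⟩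
  have h₂ := dist_mul_extend_truncSlope B (q := fun p => p.1.2) (by fun_prop) ⟨(u, y), huy⟩
  have h₃ := dist_mul_extend_truncSlope B (q := fun p => p.1.2) (by fun_prop) ⟨(x, y), hxy⟩
  rw [h₁, h₂, h₃]
  have := dist_triangle x u y
  have := truncInfDist_le_add B y u
  rw [dist_comm y u] at this
  have := (truncInfDist B u).2.1
  have := dist_nonneg (x := x) (y := u)
  grind

/-! ### Shadows and extended supports -/

theorem continuous_p₁ : Continuous (p₁ : StoneCech (Pairs M) → UComp M) :=
  continuous_stoneCechExtend _

theorem continuous_p₂ : Continuous (p₂ : StoneCech (Pairs M) → UComp M) :=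
  continuous_stoneCechExtend _

theorem p₁_unit (p : Pairs M) : p₁ (stoneCechUnit p) = toUComp p.1.1 :=
  stoneCechExtend_stoneCechUnit _ p

theorem p₂_unit (p : Pairs M) : p₂ (stoneCechUnit p) = toUComp p.1.2 :=
  stoneCechExtend_stoneCechUnit _ p

/-- A point outside the extended support is outside the closure of a single set `A` off which
`Φ*μ` is zero; the test functions built from `A ∪ {o}` then show that `μ` does not charge the pairs
with a coordinate near that point. -/
theorem IsMinimal.shadow_support_subset (hM : ∃ x y z : M, x ≠ y ∧ y ≠ z ∧ x ≠ z)
    {μ : Measure (StoneCech (Pairs M))} [IsFiniteMeasure μ] (hmin : IsMinimal μ)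
    (hconc : μ (dExt ⁻¹' Ico 0 ⊤)ᶜ = 0) :
    shadow μ.support ⊆ extendedSupport (dualDeLeeuw o μ) ∪ {toUComp o} := by
  intro ξ hξ
  by_contra hnot
  simp only [extendedSupport, mem_union, mem_iInter, mem_ofPred_eq, mem_singleton_iff, not_or,
    not_forall] at hnot
  obtain ⟨⟨A, hA, hξA⟩, hξo⟩ := hnot
  set B := insert o A with hBdef
  have hoB : o ∈ B := mem_insert o A
  have hB : ∀ f : Lip0 M o, (∀ x ∈ B, f x = 0) → dualDeLeeuw o μ f = 0 := fun f hf =>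
    hA f fun x hx => hf x (mem_insert_of_mem o hx)
  have hξB : 0 < truncInfDistExt B ξ := by
    refine truncInfDistExt_pos ⟨o, hoB⟩ ?_
    rw [hBdef, image_insert_eq, insert_eq, closure_union, closure_singleton]
    exact fun h => h.elim hξo hξA
  have hzero : ∀ x, 0 ≤ (truncInfDist B x : ℝ) := fun x => (truncInfDist B x).2.1
  rcases hξ with ⟨ζ, hζ, rfl⟩ | ⟨ζ, hζ, rfl⟩
  · refine hξB.not_ge (truncInfDistExt_eq_zero_of_mem_support hconc _ continuous_p₁ p₁_unit
      (hmin.integral_eq_zero (extend_truncSlope_fst_mem_coneG B) (extend_truncSlope_nonneg B _)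
        fun g hg hfg => ?_) hζ)
    refine integral_nonneg_of_cost_bound_left hM hoB hB hg
      (fun x hx => truncInfDist_of_mem hx) fun x y => ?_
    by_cases hxy : x = y
    · simpa [hxy, cost_self] using hzero y
    · exact neg_truncInfDist_le_cost hfg ⟨(x, y), hxy⟩
  · refine hξB.not_ge (truncInfDistExt_eq_zero_of_mem_support hconc _ continuous_p₂ p₂_unit
      (hmin.integral_eq_zero (extend_truncSlope_snd_mem_coneG B) (extend_truncSlope_nonneg B _)
        fun g hg hfg => ?_) hζ)
    refine integral_nonneg_of_cost_bound_right hM hoB hB hg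
      (fun x hx => truncInfDist_of_mem hx) fun x y => ?_
    by_cases hxy : x = y
    · simpa [hxy, cost_self] using hzero y
    · exact neg_truncInfDist_le_cost hfg ⟨(x, y), hxy⟩

theorem isClosed_shadow {E : Set (StoneCech (Pairs M))} (hE : IsClosed E) :
    IsClosed (shadow E) :=
  ((hE.isCompact.image continuous_p₁).union (hE.isCompact.image continuous_p₂)).isClosed

/-- If `W` is an open neighbourhood of the shadow of the support of `ν`, then a function vanishing
on `W ∩ M` has De Leeuw transform zero on that support. So `W ∩ M` is one of the sets whose closures
cut out the extended support, and such closures separate the shadow from any other point. -/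
theorem extendedSupport_subset_shadow_support (ν : Measure (StoneCech (Pairs M)))
    [IsFiniteMeasure ν] [ν.Regular] :
    extendedSupport (dualDeLeeuw o ν) ⊆ shadow ν.support := by
  intro ξ hξ
  by_contra hnot
  obtain ⟨W, V, hW, hV, hsW, hξV, hWV⟩ :=
    (isClosed_shadow Measure.isClosed_support).isCompact.separation_of_notMem hnot
  have hcl : closure (toUComp '' (toUComp ⁻¹' W : Set M)) ⊆ Vᶜ :=
    closure_minimal ((image_preimage_subset _ _).trans hWV.subset_compl_right) hV.isClosed_compl
  refine hcl (mem_iInter₂.1 hξ _ fun f hf => ?_) hξV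
  refine integral_eq_zero_of_ae ?_
  filter_upwards [Measure.support_mem_ae_of_regular (μ := ν)] with ζ hζ
  refine subset_of_stoneCechUnit_mem
    ((hW.preimage continuous_p₁).inter (hW.preimage continuous_p₂))
    (isClosed_eq (map_continuous (deLeeuw M o f)) continuous_const) (fun p hp => ?_)
    ⟨hsW (Or.inl (mem_image_of_mem _ hζ)), hsW (Or.inr (mem_image_of_mem _ hζ))⟩
  obtain ⟨h₁, h₂⟩ := hp
  rw [mem_preimage, p₁_unit] at h₁
  rw [mem_preimage, p₂_unit] at h₂
  rw [mem_ofPred_eq, deLeeuw_unit, hf _ h₁, hf _ h₂, sub_self, zero_div]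
  rfl

end LipFree

end

theorem theorem3p3 {M : Type*} [MetricSpace M] [CompleteSpace M] (o : M)
    (hM : ∃ x y z : M, x ≠ y ∧ y ≠ z ∧ x ≠ z)
    (μ : MeasureTheory.Measure (StoneCech (LipFree.Pairs M)))
    [MeasureTheory.IsFiniteMeasure μ] [μ.Regular]
    (hmin : LipFree.IsMinimal μ)
    (hconc : μ (LipFree.dExt ⁻¹' Set.Ico 0 ⊤)ᶜ = 0) :
    LipFree.shadow μ.support ⊆
        LipFree.extendedSupport (LipFree.dualDeLeeuw o μ) ∪ {LipFree.toUComp o} ∧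
      ∀ (ν : MeasureTheory.Measure (StoneCech (LipFree.Pairs M)))
        [MeasureTheory.IsFiniteMeasure ν] [ν.Regular],
        LipFree.dualDeLeeuw o ν = LipFree.dualDeLeeuw o μ →
          LipFree.shadow μ.support ⊆ LipFree.shadow ν.support ∪ {LipFree.toUComp o} := by
  have h := hmin.shadow_support_subset (o := o) hM hconc
  refine ⟨h, fun ν _ _ hν => h.trans (union_subset_union_left _ ?_)⟩
  rw [← hν]
  exact LipFree.extendedSupport_subset_shadow_support ν
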